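/- Let $(\Omega,\mathcal F,\mathbb P)$ be a probability space with a right-continuous filtration $(\mathcal F_t)_{t\ge 0}$, let $\mathcal X\subseteq\mathbb R^n$ be open and connected, and let $X=(X_t)_{t\ge 0}$ be an adapted $\mathcal X$-valued process with continuous paths. For $0\le s<T<\infty$ let $C([s,T];\mathcal X)$ be the space of continuous maps $[s,T]\to\mathcal X$ with the uniform metric and its Borel $\sigma$-algebra. Assume that $X$ has conditional full support: for all deterministic times $0\le s<T<\infty$, the support of the regular conditional distribution of the path $X|_{[s,T]}$ given $\mathcal F_s$, a random probability measure on $C([s,T];\mathcal X)$, is almost surely equal to $\{x\in C([s,T];\mathcal X) : x(s)=X_s\}$. Let $f:\mathcal X\to[0,\infty)$ be continuous with $0\in f(\mathcal X)$. Then the process \[ U_t=\int_0^t f(X_s)\,ds,\qquad t\ge 0, \] is sticky. That is, for every $T\in[0,\infty)$, every stopping time $\tau$ with values in $[0,\infty]$, and every almost surely strictly positive $\mathcal F_\tau$-measurable random variable $\varepsilon$, the stopped process $U^T_t=U_{t\wedge T}$ satisfies \[ \mathbb P\Big(\sup_{t\in[\tau,\infty)}\big|U^T_t-U^T_\tau\big|\le\varepsilon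 \,\Big|\, \mathcal F_\tau\Big)>0\quad\text{almost surely,} \] where the supremum over the empty set (on $\{\tau=\infty\}$) is $-\infty$. -/

import Mathlib

open MeasureTheory ProbabilityTheory
open scoped NNReal

section Sticky

/-- A process `X` is globally sticky if `ℙ(sup_{t ≥ τ} d(X_t, X_τ) ≤ ε | ℱ_τ) > 0` almost surely,
for every stopping time `τ` (possibly infinite) and every strictly positive `ℱ_τ`-measurable
random variable `ε`. On `{τ = ∞}` the supremum is over the empty set, and the bound holds. -/
def IsGloballySticky {Ω E : Type*} [PseudoMetricSpace E] {mΩ : MeasurableSpace Ω} (ℱ : Filtration ℝ≥0 mΩ)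
    (X : ℝ≥0 → Ω → E) (μ : Measure Ω) : Prop :=
  ∀ (τ : Ω → WithTop ℝ≥0) (hτ : IsStoppingTime ℱ τ) (ε : Ω → ℝ),
    Measurable[hτ.measurableSpace] ε → (∀ᵐ ω ∂μ, 0 < ε ω) →
      ∀ᵐ ω ∂μ, 0 < (μ⟦{ω' | ∀ t : ℝ≥0, τ ω' ≤ (t : WithTop ℝ≥0) →
        dist (X t ω') (stoppedValue X τ ω') ≤ ε ω'} | hτ.measurableSpace⟧) ω

/-- A process `X` is sticky if, for every deterministic time `T`, the stopped process
`(X_{t ∧ T})_{t ≥ 0}` is globally sticky. -/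
def IsSticky {Ω E : Type*} [PseudoMetricSpace E] {mΩ : MeasurableSpace Ω} (ℱ : Filtration ℝ≥0 mΩ)
    (X : ℝ≥0 → Ω → E) (μ : Measure Ω) : Prop :=
  ∀ T : ℝ≥0, IsGloballySticky ℱ (fun t ω => X (min t T) ω) μ

end Sticky

section ConditionalFullSupport

/-- The Borel σ-algebra on a space of continuous maps; on a compact domain the topology is that of
the uniform metric. -/
instance continuousMapMeasurableSpace {α β : Type*} [TopologicalSpace α] [TopologicalSpace β] :
    MeasurableSpace C(α, β) := borel _

instance continuousMapBorelSpace {α β : Type*} [TopologicalSpace α] [TopologicalSpace β] :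
    BorelSpace C(α, β) := ⟨rfl⟩

/-- The Markov kernel `κ` from `(Ω, m)` to `F` is a regular conditional distribution
of the random element `Y` of `F` given the σ-algebra `m`. -/
structure IsRegularCondDistrib {Ω F : Type*} [MeasurableSpace F] (m : MeasurableSpace Ω)
    {mΩ : MeasurableSpace Ω} (Y : Ω → F) (μ : Measure Ω) (κ : @Kernel Ω F m _) : Prop where
  isMarkovKernel : IsMarkovKernel κ
  condProb_eq : ∀ A : Set F, MeasurableSet A →
    (fun ω => (κ ω).real A) =ᵐ[μ] μ⟦Y ⁻¹' A | m⟧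

/-- The restriction of the path `t ↦ X_t(ω)` to `[s, T]`, as an element of `C([s, T]; E)`. -/
def pathOn {Ω E : Type*} [TopologicalSpace E] (X : ℝ≥0 → Ω → E)
    (hX : ∀ ω, Continuous fun t => X t ω) (s T : ℝ≥0) (ω : Ω) : C(Set.Icc s T, E) :=
  ⟨fun t => X t ω, (hX ω).comp continuous_subtype_val⟩

/-- Conditional full support of a process with continuous paths: for all deterministic times
`0 ≤ s < T`, the support of the regular conditional distribution of `X|_[s, T]` given `ℱ_s` is
almost surely the set of all continuous paths on `[s, T]` that start from `X_s` at time `s`. -/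
def HasConditionalFullSupport {Ω E : Type*} [TopologicalSpace E] {mΩ : MeasurableSpace Ω}
    (ℱ : Filtration ℝ≥0 mΩ)
    (X : ℝ≥0 → Ω → E) (hX : ∀ ω, Continuous fun t => X t ω) (μ : Measure Ω) : Prop :=
  ∀ (s T : ℝ≥0) (hsT : s < T), ∃ κ : @Kernel Ω C(Set.Icc s T, E) (ℱ s) _,
    IsRegularCondDistrib (ℱ s) (pathOn X hX s T) μ κ ∧
      ∀ᵐ ω ∂μ, (κ ω).support =
        {x : C(Set.Icc s T, E) | x ⟨s, Set.left_mem_Icc.mpr hsT.le⟩ = X s ω}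

end ConditionalFullSupport

/-! ### Measurability, continuity and monotonicity of time integrals -/

section TimeIntegral

variable {Ω : Type*}

/-- The integral over `[a, b]` of a continuous process is measurable with respect to any σ-algebra
that makes the process measurable up to time `b`. -/
lemma measurable_timeIntegral {m : MeasurableSpace Ω} {g : ℝ≥0 → Ω → ℝ}
    (hg : ∀ ω, Continuous fun t => g t ω) {a : ℝ} {b : ℝ≥0} (hab : a ≤ b)
    (hm : ∀ t ≤ b, Measurable (g t)) :
    Measurable fun ω => ∫ s in a..b, g s.toNNReal ω := by
  -- Freezing time at `b` uses only the `g t` with `t ≤ b` and leaves the integral unchanged.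
  have hjoint : Measurable (Function.uncurry fun (s : ℝ) (ω : Ω) => g (min s.toNNReal b) ω) :=
    measurable_uncurry_of_continuous_of_measurable
      (fun ω => (hg ω).comp (continuous_real_toNNReal.min continuous_const))
      (fun s => hm _ (min_le_right _ _))
  have hint := (hjoint.stronglyMeasurable.integral_prod_left
    (μ := volume.restrict (Set.Ioc a (b : ℝ)))).measurable
  convert hint using 2 with ω
  rw [intervalIntegral.integral_of_le hab]
  refine setIntegral_congr_fun measurableSet_Ioc fun s hs => ?_
  have : s.toNNReal ≤ b := Real.toNNReal_le_iff_le_coe.mpr hs.2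
  simp [min_eq_left this]

lemma intervalIntegrable_comp_toNNReal {h : ℝ≥0 → ℝ} (hh : Continuous h) (a b : ℝ) :
    IntervalIntegrable (fun s : ℝ => h s.toNNReal) volume a b :=
  (hh.comp continuous_real_toNNReal).intervalIntegrable a b

lemma continuous_primitive_comp_toNNReal {h : ℝ≥0 → ℝ} (hh : Continuous h) :
    Continuous fun t : ℝ => ∫ s in (0 : ℝ)..t, h s.toNNReal :=
  intervalIntegral.continuous_primitive (intervalIntegrable_comp_toNNReal hh) 0

lemma monotone_primitive_comp_toNNReal {h : ℝ≥0 → ℝ} (hh : Continuous h) (h0 : ∀ t, 0 ≤ h t) :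
    Monotone fun t : ℝ => ∫ s in (0 : ℝ)..t, h s.toNNReal := by
  intro a b hab
  have := intervalIntegral.integral_interval_sub_left
    (intervalIntegrable_comp_toNNReal hh 0 b) (intervalIntegrable_comp_toNNReal hh 0 a)
  have hpos : 0 ≤ ∫ s in a..b, h s.toNNReal :=
    intervalIntegral.integral_nonneg hab fun _ _ => h0 _
  simp only
  linarith

/-- A continuous function on the half line oscillates little between some rationals on either side
of a given time. -/
lemma exists_rat_lt_sub_le {v : ℝ → ℝ} (hv : Continuous v) {t T η : ℝ} (htT : t < T)
    (hη : 0 < η) : ∃ p q : ℚ, (p : ℝ) < t ∧ t < q ∧ (q : ℝ) < T ∧ v q - v p ≤ η := by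
  obtain ⟨δ, hδ, hball⟩ := Metric.continuous_iff.mp hv t (η / 2) (half_pos hη)
  obtain ⟨p, hp₁, hp₂⟩ := exists_rat_btwn (show t - δ < t by linarith)
  obtain ⟨q, hq₁, hq₂⟩ := exists_rat_btwn (show t < min (t + δ) T from lt_min (by linarith) htT)
  refine ⟨p, q, hp₂, hq₁, hq₂.trans_le (min_le_right _ _), ?_⟩
  have h₁ := hball p (by rw [Real.dist_eq, abs_lt]; constructor <;> linarith)
  have h₂ := hball q (by
    rw [Real.dist_eq, abs_lt]; constructor <;> linarith [min_le_left (t + δ) T])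
  rw [Real.dist_eq, abs_lt] at h₁ h₂
  linarith

end TimeIntegral

/-! ### Reduction from stopping times to deterministic times -/

section Stickiness

variable {Ω : Type*} {mΩ : MeasurableSpace Ω} {μ : Measure Ω}

/-- A conditional probability is positive almost surely if every conditioning event that
avoids `E` is null. -/
lemma ae_condProb_pos_of_forall {Ω : Type*} {m mΩ : MeasurableSpace Ω} {μ : Measure Ω}
    [IsFiniteMeasure μ] (hm : m ≤ mΩ)
    {E : Set Ω} (hE : MeasurableSet E)
    (h : ∀ A, MeasurableSet[m] A → μ (A ∩ E) = 0 → μ A = 0) :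
    ∀ᵐ ω ∂μ, 0 < (μ⟦E | m⟧) ω := by
  have hA : MeasurableSet[m] {ω | (μ⟦E | m⟧) ω ≤ 0} :=
    measurableSet_le stronglyMeasurable_condExp.measurable measurable_const
  have hint : Integrable (E.indicator fun _ => (1 : ℝ)) μ :=
    (integrable_const (1 : ℝ)).indicator hE
  have key := setIntegral_condExp hm hint hA
  rw [setIntegral_indicator hE] at key
  simp only [integral_const, smul_eq_mul, mul_one, MeasurableSet.univ, measureReal_restrict_apply,
    Set.univ_inter] at key
  have hle : ∫ ω in {ω | (μ⟦E | m⟧) ω ≤ 0}, (μ⟦E | m⟧) ω ∂μ ≤ 0 :=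
    setIntegral_nonpos (hm _ hA) fun ω hω => hω
  have hzero : μ ({ω | (μ⟦E | m⟧) ω ≤ 0} ∩ E) = 0 := by
    rw [← measureReal_eq_zero_iff]
    exact le_antisymm (key ▸ hle) measureReal_nonneg
  have := h _ hA hzero
  rw [ae_iff]
  simpa only [not_lt] using this

variable {ℱ : Filtration ℝ≥0 mΩ} {g : ℝ≥0 → Ω → ℝ}

/-- Monotonicity collapses the uncountable condition over `t` to the single bound at `T`; on `{τ =
⊤}` it is vacuous. -/
lemma measurableSet_forall_dist_stoppedValue_le
    (hg : ∀ ω, Continuous fun t => g t ω) (hg0 : ∀ t ω, 0 ≤ g t ω) (hm : ∀ t, Measurable (g t))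
    (T : ℝ≥0) {τ : Ω → WithTop ℝ≥0} (hτ : Measurable τ) {ε : Ω → ℝ} (hε : Measurable ε) :
    MeasurableSet {ω | ∀ t : ℝ≥0, τ ω ≤ (t : WithTop ℝ≥0) →
      dist (∫ s in (0 : ℝ)..(min t T : ℝ≥0), g s.toNNReal ω)
        (stoppedValue (fun t ω => ∫ s in (0 : ℝ)..(min t T : ℝ≥0), g s.toNNReal ω) τ ω) ≤ ε ω} := by
  set U : ℝ≥0 → Ω → ℝ := fun t ω => ∫ s in (0 : ℝ)..(min t T : ℝ≥0), g s.toNNReal ω with hU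
  have hUc : ∀ ω, Continuous fun t => U t ω := fun ω =>
    (continuous_primitive_comp_toNNReal (hg ω)).comp
      (NNReal.continuous_coe.comp (continuous_id.min continuous_const))
  have hUm : ∀ t, Measurable (U t) := fun t =>
    measurable_timeIntegral hg (NNReal.coe_nonneg _) fun t _ => hm t
  have hUmono : ∀ ω, Monotone fun t => U t ω := fun ω a b hab =>
    monotone_primitive_comp_toNNReal (hg ω) (hg0 · ω)
      (NNReal.coe_le_coe.mpr (min_le_min_right T hab))
  have hUT : ∀ t ω, T ≤ t → U t ω = U T ω := fun t ω h => by
    simp only [hU, min_eq_right h, min_self]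
  have hUτ : Measurable (stoppedValue U τ) :=
    (measurable_uncurry_of_continuous_of_measurable hUc hUm).comp
      ((WithTop.measurable_untopA.comp hτ).prodMk measurable_id)
  have hset : {ω | ∀ t : ℝ≥0, τ ω ≤ (t : WithTop ℝ≥0) →
      dist (U t ω) (stoppedValue U τ ω) ≤ ε ω} =
      {ω | τ ω = ⊤} ∪ {ω | U T ω - stoppedValue U τ ω ≤ ε ω} := by
    ext ω
    simp only [Set.mem_ofPred_eq, Set.mem_union, stoppedValue]
    cases hτω : τ ω with
    | top =>
      exact iff_of_true (fun t ht => absurd (top_le_iff.mp ht) WithTop.coe_ne_top) (Or.inl rfl)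
    | coe r =>
      simp only [WithTop.coe_le_coe, WithTop.coe_ne_top, false_or, WithTop.untopD_coe]
      constructor
      · intro h
        have := h (max r T) (le_max_left _ _)
        rw [hUT _ _ (le_max_right _ _)] at this
        exact (le_abs_self _).trans this
      · intro h t ht
        have h₁ : U t ω ≤ U T ω := by
          rw [← hUT (max t T) ω (le_max_right _ _)]
          exact hUmono ω (le_max_left _ _)
        have h₂ : U r ω ≤ U t ω := hUmono ω ht
        rw [Real.dist_eq, abs_of_nonneg (by linarith)]
        linarith
  rw [hset]
  exact (hτ (measurableSet_singleton _)).union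
    (measurableSet_le ((hUm T).sub hUτ) hε)

/-- The time integral of a nonnegative continuous adapted process is sticky if, at every
deterministic time, it has a positive conditional probability of growing little up to a given
horizon. -/
theorem isSticky_timeIntegral [IsFiniteMeasure μ]
    (hg : ∀ ω, Continuous fun t => g t ω) (hg0 : ∀ t ω, 0 ≤ g t ω) (hm : ∀ t, Measurable[ℱ t] (g t))
    (H : ∀ (s T : ℝ≥0), s < T → ∀ η : ℝ, 0 < η → ∀ B, MeasurableSet[ℱ s] B →
      μ (B ∩ {ω | ∫ u in (s : ℝ)..T, g u.toNNReal ω ≤ η}) = 0 → μ B = 0) :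
    IsSticky ℱ (fun (t : ℝ≥0) (ω : Ω) => ∫ s in (0 : ℝ)..t, g s.toNNReal ω) μ := by
  intro T τ hτ ε hε hε0
  have hεΩ : Measurable ε := hε.mono hτ.measurableSpace_le le_rfl
  refine ae_condProb_pos_of_forall hτ.measurableSpace_le
    (measurableSet_forall_dist_stoppedValue_le hg hg0 (fun t => (hm t).mono (ℱ.le t) le_rfl) T
      hτ.measurable' hεΩ) fun A hA hAE => ?_
  set E := {ω | ∀ t : ℝ≥0, τ ω ≤ (t : WithTop ℝ≥0) →
      dist (∫ s in (0 : ℝ)..(min t T : ℝ≥0), g s.toNNReal ω)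
        (stoppedValue (fun t ω => ∫ s in (0 : ℝ)..(min t T : ℝ≥0), g s.toNNReal ω) τ ω) ≤ ε ω}
  let V : ℝ → Ω → ℝ := fun t ω => ∫ s in (0 : ℝ)..t, g s.toNNReal ω
  have hVmono : ∀ ω, Monotone fun t => V t ω := fun ω =>
    monotone_primitive_comp_toNNReal (hg ω) (hg0 · ω)
  have hVsub : ∀ a b ω, ∫ s in a..b, g s.toNNReal ω = V b ω - V a ω := fun a b ω =>
    (intervalIntegral.integral_interval_sub_left
      (intervalIntegrable_comp_toNNReal (hg ω) 0 b)
      (intervalIntegrable_comp_toNNReal (hg ω) 0 a)).symm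
  have hVm : ∀ t q : ℝ≥0, t ≤ q → Measurable[ℱ q] (V t) := fun t q htq =>
    (measurable_timeIntegral hg t.coe_nonneg
      (fun u hu => (hm u).mono (ℱ.mono hu) le_rfl)).mono (ℱ.mono htq) le_rfl
  -- Half of the budget `2 * η < ε` is spent on `[p, q]`, half is kept for `[q, T]`.
  let B : ℝ≥0 → ℝ≥0 → ℚ → Set Ω := fun p q η =>
    ((A ∩ {ω | 2 * (η : ℝ) < ε ω}) ∩ {ω | τ ω ≤ q}) ∩
      ({ω | τ ω < p}ᶜ ∩ {ω | V q ω - V p ω ≤ η})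
  have hBnull : ∀ (p q : ℝ≥0) (η : ℚ), p ≤ q → q < T → 0 < η → μ (B p q η) = 0 := by
    intro p q η hpq hqT hη
    refine H q T hqT η (by exact_mod_cast hη) _ ?_ (measure_mono_null ?_ hAE)
    -- An `ℱ_τ`-event intersected with `{τ ≤ q}` lies in `ℱ q`.
    · exact ((hA.inter (hε measurableSet_Ioi)).2 q).inter
        (((ℱ.mono hpq _ (hτ.measurableSet_lt p)).compl).inter
          (measurableSet_le ((hVm q q le_rfl).sub (hVm p q hpq)) measurable_const))
    · rintro ω ⟨⟨⟨⟨hωA, hωε⟩, hτq⟩, hpτ, hpqη⟩, hqTη⟩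
      refine ⟨hωA, fun t ht => ?_⟩
      simp only [Set.mem_ofPred_eq, Set.mem_compl_iff, not_lt, hVsub] at hωε hτq hpτ hpqη hqTη
      simp only [stoppedValue]
      obtain ⟨r, hr⟩ := WithTop.ne_top_iff_exists.mp (ne_top_of_le_ne_top WithTop.coe_ne_top hτq)
      rw [← hr] at hτq hpτ ht ⊢
      rw [WithTop.coe_le_coe] at hτq hpτ ht
      change dist (V (min t T : ℝ≥0) ω) (V (min r T : ℝ≥0) ω) ≤ ε ω
      have h₁ : V (min r T : ℝ≥0) ω ≤ V (min t T : ℝ≥0) ω :=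
        hVmono ω (NNReal.coe_le_coe.mpr (min_le_min_right T ht))
      have h₂ : V (min t T : ℝ≥0) ω ≤ V T ω :=
        hVmono ω (NNReal.coe_le_coe.mpr (min_le_right _ _))
      have h₃ : V p ω ≤ V (min r T : ℝ≥0) ω :=
        hVmono ω (NNReal.coe_le_coe.mpr (le_min hpτ (hpq.trans hqT.le)))
      rw [Real.dist_eq, abs_of_nonneg (by linarith)]
      linarith
  have hcover : A ⊆ (A ∩ E) ∪ {ω | ¬ 0 < ε ω} ∪ ⋃ (i : ℚ × ℚ × ℚ),
      if (i.1 : ℝ).toNNReal ≤ (i.2.1 : ℝ).toNNReal ∧ (i.2.1 : ℝ).toNNReal < T ∧ 0 < i.2.2 then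
        B (i.1 : ℝ).toNNReal (i.2.1 : ℝ).toNNReal i.2.2 else ∅ := by
    intro ω hωA
    by_cases hεω : 0 < ε ω
    swap
    · exact Or.inl (Or.inr hεω)
    by_cases hτT : τ ω < T
    · right
      obtain ⟨r, hr⟩ := WithTop.ne_top_iff_exists.mp hτT.ne_top
      rw [← hr, WithTop.coe_lt_coe] at hτT
      obtain ⟨η, hη0, hη⟩ := exists_rat_btwn (half_pos hεω)
      -- The rational below `τ` may be negative (as when `τ = 0`); `toNNReal` sends it to `0`.
      have hVc : Continuous fun t : ℝ => V (t.toNNReal) ω :=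
        (continuous_primitive_comp_toNNReal (hg ω)).comp
          (NNReal.continuous_coe.comp continuous_real_toNNReal)
      obtain ⟨p, q, hp, hq, hqT, hpq⟩ :=
        exists_rat_lt_sub_le hVc (NNReal.coe_lt_coe.mpr hτT) hη0
      have hpr : (p : ℝ).toNNReal ≤ r := Real.toNNReal_le_iff_le_coe.mpr hp.le
      have hrq : r ≤ (q : ℝ).toNNReal := NNReal.le_toNNReal_of_coe_le hq.le
      have hqT' : (q : ℝ).toNNReal < T :=
        (Real.toNNReal_lt_iff_lt_coe (r.coe_nonneg.trans hq.le)).mpr hqT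
      refine Set.mem_iUnion.mpr ⟨(p, q, η), ?_⟩
      rw [if_pos ⟨hpr.trans hrq, hqT', by exact_mod_cast hη0⟩]
      refine ⟨⟨⟨hωA, ?_⟩, ?_⟩, ?_, hpq⟩
      · simp only [Set.mem_ofPred_eq]; linarith
      · simp only [Set.mem_ofPred_eq, ← hr]; exact_mod_cast hrq
      · simp only [Set.mem_ofPred_eq, Set.mem_compl_iff, not_lt, ← hr]; exact_mod_cast hpr
    · refine Or.inl (Or.inl ⟨hωA, fun t ht => ?_⟩)
      have hTt : T ≤ t := by exact_mod_cast (not_lt.mp hτT).trans ht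
      have hTτ : T ≤ (τ ω).untopA := by
        obtain ⟨r, hr⟩ := WithTop.ne_top_iff_exists.mp (ne_top_of_le_ne_top WithTop.coe_ne_top ht)
        rw [← hr] at hτT ⊢
        exact_mod_cast not_lt.mp hτT
      simp only [stoppedValue, min_eq_right hTt, min_eq_right hTτ, dist_self]
      exact hεω.le
  refine measure_mono_null hcover
    (measure_union_null (measure_union_null hAE (ae_iff.mp hε0)) (measure_iUnion_null fun i => ?_))
  split_ifs with hi
  · exact hBnull _ _ _ hi.1 hi.2.1 hi.2.2
  · exact measure_empty

end Stickiness

/-! ### Paths with small integral -/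

section SmallIntegralPaths

variable {E : Type*} [TopologicalSpace E]

/-- This makes small integral an open condition on paths. `projIcc` only makes the integrand total.
-/
lemma continuous_integral_projIcc {s T : ℝ≥0} (hsT : s ≤ T) {f : E → ℝ} (hf : Continuous f) :
    Continuous fun x : C(Set.Icc s T, E) =>
      ∫ u in (s : ℝ)..T, f (x (Set.projIcc s T hsT u.toNNReal)) := by
  let F : C(Set.Icc s T, E) → C(Set.Icc s T, ℝ) := fun x => ContinuousMap.comp ⟨f, hf⟩ x
  have hF : Continuous F := ContinuousMap.continuous_postcomp _
  have hI : Continuous fun y : C(Set.Icc s T, ℝ) =>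
      ∫ u in (s : ℝ)..T, y (Set.projIcc s T hsT u.toNNReal) := by
    refine intervalIntegral.continuous_parametric_intervalIntegral_of_continuous' ?_ _ _
    have : Continuous fun u : ℝ => Set.projIcc s T hsT u.toNNReal :=
      continuous_projIcc.comp continuous_real_toNNReal
    exact continuous_eval.comp (continuous_fst.prodMk (this.comp continuous_snd))
  exact hI.comp hF

/-- From any point of a path connected space there is a path on `[s, T]` which quickly reaches a
given zero of `f` and stays there, so that the integral of `f` along it is small. -/
lemma exists_path_integral_lt [PathConnectedSpace E] {s T : ℝ≥0} (hsT : s < T) {f : E → ℝ}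
    (hf : Continuous f) {z : E} (hz : f z = 0) (a : E) {η : ℝ} (hη : 0 < η) :
    ∃ x : C(Set.Icc s T, E), x ⟨s, Set.left_mem_Icc.mpr hsT.le⟩ = a ∧
      ∫ u in (s : ℝ)..T, f (x (Set.projIcc s T hsT.le u.toNNReal)) < η := by
  obtain ⟨γ⟩ := PathConnectedSpace.joined a z
  obtain ⟨M, hM⟩ := (isCompact_range (hf.comp γ.continuous)).bddAbove
  have hM' : ∀ u : ℝ, f (γ.extend u) ≤ max M 1 := fun u =>
    (hM ⟨Set.projIcc 0 1 zero_le_one u, rfl⟩).trans (le_max_left _ _)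
  have hsT' : (0 : ℝ) < T - s := sub_pos.mpr (NNReal.coe_lt_coe.mpr hsT)
  -- The maximum with `1` allows division even if `f` vanishes along `γ`.
  have hMpos : (0 : ℝ) < max M 1 := lt_max_of_lt_right one_pos
  obtain ⟨δ, hδ0, hδ⟩ : ∃ δ : ℝ, 0 < δ ∧ δ < min (T - s : ℝ) (η / max M 1) :=
    exists_between (lt_min hsT' (div_pos hη hMpos))
  have hδT : s + δ < T := by linarith [min_le_left (T - s : ℝ) (η / max M 1)]
  have hδη : δ * max M 1 < η := (lt_div_iff₀ hMpos).mp (hδ.trans_le (min_le_right _ _))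
  -- `γ` is run in time `δ`, at cost at most `δ * max M 1 < η`; afterwards `extend` rests at `z`.
  let ψ : ℝ → ℝ := fun u => f (γ.extend ((u - s) / δ))
  have hψ : Continuous ψ := hf.comp (γ.continuous_extend.comp (by fun_prop))
  let x : C(Set.Icc s T, E) :=
    ⟨fun t => γ.extend (((t : ℝ≥0) - s : ℝ) / δ), γ.continuous_extend.comp (by fun_prop)⟩
  refine ⟨x, by simp [x], ?_⟩
  have hcongr : ∫ u in (s : ℝ)..T, f (x (Set.projIcc s T hsT.le u.toNNReal)) =
      ∫ u in (s : ℝ)..T, ψ u := by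
    refine intervalIntegral.integral_congr fun u hu => ?_
    rw [Set.uIcc_of_le (by exact_mod_cast hsT.le)] at hu
    have hu' : u.toNNReal ∈ Set.Icc s T :=
      ⟨NNReal.le_toNNReal_of_coe_le hu.1, Real.toNNReal_le_iff_le_coe.mpr hu.2⟩
    simp only [x, ψ, ContinuousMap.coe_mk, Set.projIcc_of_mem _ hu',
      Real.coe_toNNReal u (s.coe_nonneg.trans hu.1)]
  rw [hcongr, ← intervalIntegral.integral_add_adjacent_intervals
    (hψ.intervalIntegrable s (s + δ)) (hψ.intervalIntegrable (s + δ) T)]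
  have h₁ : ∫ u in (s : ℝ)..(s + δ), ψ u ≤ δ * max M 1 := by
    have := intervalIntegral.integral_mono_on (by linarith) (hψ.intervalIntegrable s (s + δ))
      (intervalIntegrable_const (μ := volume) (c := max M 1)) fun u _ => hM' ((u - s) / δ)
    simpa using this
  have h₂ : ∫ u in (s + δ : ℝ)..T, ψ u = 0 := by
    refine (intervalIntegral.integral_congr (g := fun _ => 0) fun u hu => ?_).trans (by simp)
    rw [Set.uIcc_of_le hδT.le] at hu
    have : 1 ≤ (u - s) / δ := by rw [le_div_iff₀ hδ0]; linarith [hu.1]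
    simp only [ψ, γ.extend_of_one_le this, hz]
  linarith

end SmallIntegralPaths

/-! ### From conditional full support to small integrals -/

section ConditionalFullSupportIntegral

variable {Ω E : Type*} [TopologicalSpace E] {mΩ : MeasurableSpace Ω} {μ : Measure Ω}

/-- An event of the conditioning σ-algebra is null if it is almost surely disjoint from an event
`Y ∈ O` which has positive regular conditional probability. -/
lemma measure_eq_zero_of_regularCondDistrib_pos {Ω F : Type*} [MeasurableSpace F]
    {m mΩ : MeasurableSpace Ω} {μ : Measure Ω} [IsFiniteMeasure μ] (hm : m ≤ mΩ) {Y : Ω → F} {κ : @Kernel Ω F m _}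
    (hκ : IsRegularCondDistrib m Y μ κ) {O : Set F} (hO : MeasurableSet O)
    (hYO : MeasurableSet (Y ⁻¹' O)) (hpos : ∀ᵐ ω ∂μ, 0 < κ ω O)
    {B : Set Ω} (hB : MeasurableSet[m] B) (hBO : μ (B ∩ Y ⁻¹' O) = 0) : μ B = 0 := by
  have hint : Integrable ((Y ⁻¹' O).indicator fun _ => (1 : ℝ)) μ :=
    (integrable_const (1 : ℝ)).indicator hYO
  have key := setIntegral_condExp hm hint hB
  rw [setIntegral_indicator hYO] at key
  rw [Measure.restrict_eq_zero.mpr hBO, integral_zero_measure] at key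
  have hcond : ∀ᵐ ω ∂μ, 0 < (μ⟦Y ⁻¹' O | m⟧) ω := by
    filter_upwards [hκ.condProb_eq O hO, hpos] with ω hω hωpos
    have := hκ.isMarkovKernel
    rw [← hω]
    exact ENNReal.toReal_pos hωpos.ne' (measure_ne_top _ _)
  -- An almost surely positive function with zero integral over `B` forces `B` to be null.
  have hzero := (setIntegral_eq_zero_iff_of_nonneg_ae
    (ae_restrict_of_ae (hcond.mono fun ω h => h.le)) integrable_condExp.integrableOn).mp key
  have hfalse : ∀ᵐ ω ∂μ.restrict B, False := by
    filter_upwards [hzero, ae_restrict_of_ae hcond] with ω h₁ h₂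
    exact h₂.ne' h₁
  simpa using hfalse

/-- Under conditional full support, the integral of `f` along the process has positive
conditional probability of being small. -/
lemma measure_eq_zero_of_conditionalFullSupport [PathConnectedSpace E]
    [IsFiniteMeasure μ] {ℱ : Filtration ℝ≥0 mΩ} {X : ℝ≥0 → Ω → E}
    {hX : ∀ ω, Continuous fun t => X t ω} (hcfs : HasConditionalFullSupport ℱ X hX μ)
    {f : E → ℝ} (hf : Continuous f) (hfX : ∀ t, Measurable fun ω => f (X t ω))
    (hzero : ∃ z, f z = 0) {s T : ℝ≥0} (hsT : s < T) {η : ℝ} (hη : 0 < η)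
    {B : Set Ω} (hB : MeasurableSet[ℱ s] B)
    (hBη : μ (B ∩ {ω | ∫ u in (s : ℝ)..T, f (X u.toNNReal ω) ≤ η}) = 0) : μ B = 0 := by
  obtain ⟨κ, hκ, hsupp⟩ := hcfs s T hsT
  obtain ⟨z, hz⟩ := hzero
  -- The strict inequality makes `O` open, while its preimage stays inside the event with `≤ η`.
  let O : Set C(Set.Icc s T, E) :=
    {x | ∫ u in (s : ℝ)..T, f (x (Set.projIcc s T hsT.le u.toNNReal)) < η}
  have hO : IsOpen O := isOpen_lt (continuous_integral_projIcc hsT.le hf) continuous_const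
  have hpre : pathOn X hX s T ⁻¹' O = {ω | ∫ u in (s : ℝ)..T, f (X u.toNNReal ω) < η} := by
    ext ω
    have : ∫ u in (s : ℝ)..T, f (pathOn X hX s T ω (Set.projIcc s T hsT.le u.toNNReal)) =
        ∫ u in (s : ℝ)..T, f (X u.toNNReal ω) := by
      refine intervalIntegral.integral_congr fun u hu => ?_
      rw [Set.uIcc_of_le (by exact_mod_cast hsT.le)] at hu
      have hu' : u.toNNReal ∈ Set.Icc s T :=
        ⟨NNReal.le_toNNReal_of_coe_le hu.1, Real.toNNReal_le_iff_le_coe.mpr hu.2⟩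
      simp only [pathOn, ContinuousMap.coe_mk, Set.projIcc_of_mem _ hu']
    simp only [O, Set.mem_preimage, Set.mem_ofPred_eq, this]
  refine measure_eq_zero_of_regularCondDistrib_pos (ℱ.le s) hκ hO.measurableSet ?_ ?_ hB
    (measure_mono_null (Set.inter_subset_inter_right _ ?_) hBη)
  · rw [hpre]
    exact measurableSet_lt (measurable_timeIntegral (g := fun t ω => f (X t ω))
      (fun ω => hf.comp (hX ω)) (NNReal.coe_le_coe.mpr hsT.le) fun t _ => hfX t) measurable_const
  · filter_upwards [hsupp] with ω hω
    obtain ⟨x, hxs, hxη⟩ := exists_path_integral_lt hsT hf hz (X s ω) hη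
    have hx : x ∈ (κ ω).support := by rw [hω]; exact hxs
    exact Measure.mem_support_iff_forall x |>.mp hx O (hO.mem_nhds hxη)
  · rw [hpre]
    exact fun ω (hω : _ < η) => hω.le

end ConditionalFullSupportIntegral

theorem propositionP {Ω : Type*} {mΩ : MeasurableSpace Ω} (μ : Measure Ω) [IsProbabilityMeasure μ]
    (ℱ : Filtration ℝ≥0 mΩ) [ℱ.IsRightContinuous]
    (n : ℕ) (𝒳 : Set (EuclideanSpace ℝ (Fin n))) (h𝒳_open : IsOpen 𝒳) (h𝒳_conn : IsConnected 𝒳)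
    (X : ℝ≥0 → Ω → 𝒳) (hX_adapted : Adapted ℱ X)
    (hX_cont : ∀ ω, Continuous fun t => X t ω)
    (hX_cfs : HasConditionalFullSupport ℱ X hX_cont μ)
    (f : 𝒳 → ℝ) (hf_cont : Continuous f) (hf_nonneg : ∀ x, 0 ≤ f x) (hf_zero : ∃ x, f x = 0) :
    IsSticky ℱ (fun (t : ℝ≥0) (ω : Ω) => ∫ s in (0 : ℝ)..t, f (X s.toNNReal ω)) μ := by
  have : PathConnectedSpace 𝒳 :=
    isPathConnected_iff_pathConnectedSpace.mp (h𝒳_open.isConnected_iff_isPathConnected.mp h𝒳_conn)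
  have hfX : ∀ t, Measurable[ℱ t] fun ω => f (X t ω) := fun t =>
    hf_cont.measurable.comp (hX_adapted t)
  exact isSticky_timeIntegral (g := fun t ω => f (X t ω)) (fun ω => hf_cont.comp (hX_cont ω))
    (fun t ω => hf_nonneg _) hfX fun s T hsT η hη B hB hBη =>
      measure_eq_zero_of_conditionalFullSupport hX_cfs hf_cont
        (fun t => (hfX t).mono (ℱ.le t) le_rfl) hf_zero hsT hη hB hBη
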